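/- **Theorem (Clarke–Ledyaev inequality for feasible subdifferentials).** Conventions. Let $(X,\|\cdot\|)$ be a real Banach space with closed unit ball $B_X$ and dual $X^*$. For $f:X\to\mathbb R\cup\{+\infty\}$ put $\operatorname{dom} f=\{x: f(x)<+\infty\}$ and $\inf f(A)=\inf_{x\in A}f(x)$. For $A\subset X$, $a\in X$ and $\delta>0$ put $A_\delta=A+\delta B_X$ and $[a,A]=\{a+t(x-a): t\in[0,1],\ x\in A\}$. $B^\circ(x;\varepsilon)$ is the open ball. A *subdifferential operator* $\partial$ on $X$ assigns to each lower semicontinuous $f:X\to\mathbb R\cup\{+\infty\}$ and each $x\in X$ a set $\partial f(x)\subset X^*$. Consider the following properties, for all lower semicontinuous $f,h:X\to\mathbb R\cup\{+\infty\}$: (P1) $\partial f(x)=\varnothing$ for $x\notin\operatorname{dom} f$; (P2) $\partial f(x)=\partial h(x)$ whenever $f= h$ on a neighbourhood of $x$; (P3) if $f$ is convex, and is finite and continuous on a neighbourhood of $x$, then $\partial f(x)=\{p\in X^*: f(x)+p(y-x)\le f(y)\ \ \forall y\in X\}$; (P4) if $f$ attains a local minimum at $x\in\operatorname{dom} f$,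 then $0\in\partial f(x)$; (P5) if $g:X\to\mathbb R$ is convex and continuous and $f+g$ attains its minimum at some $\bar x\in \operatorname{dom} f$, then for every $\varepsilon>0$ there exist $x,y\in B^\circ(\bar x;\varepsilon)$, $p\in\partial f(x)$ and $q\in\partial g(y)$ with $|f(x)-f(\bar x)|<\varepsilon$ and $\|p+q\|<\varepsilon$; (P6) there is a subdifferential operator $\tilde\partial$ on $X\times\mathbb R$ (with the norm $\max\{\|x\|,|t|\}$) satisfying (P1)–(P5) on $X\times\mathbb R$ such that, for every lower semicontinuous $f:X\to\mathbb R\cup\{+\infty\}$ and every $\kappa\in\mathbb R$, the function $g(x,t)=f(x)+\kappa t$ satisfies $\tilde\partial g(x,t)\subseteq\partial f(x)\times\{\kappa\}$ for all $(x,t)\in X\times\mathbb R$, where $(X\times\mathbb R)^*$ is identified with $X^*\times\mathbb R$. The operator $\partial$ is called *feasible* on $X$ if it satisfies (P1)–(P6). Statement. Let $\partial$ be a feasible subdifferential on $X$. Let $A\subset X$ be nonempty, convex, bounded and closed, let $a\in X$, let $f:X\to\mathbb R\cup\{+\infty\}$ be lower semicontinuous with $a\in\operatorname{dom} f$, and let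 $r\in\mathbb R$ satisfy $$r<\sup_{\delta>0}\inf f(A_\delta).$$ Then for every $\varepsilon>0$ there exist $\xi\in[a,A]_\varepsilon$ with $$f(\xi)<\max\{f(a),r\}+\varepsilon$$ and $p\in\partial f(\xi)$ such that $$\inf p(A)-p(a)>r-f(a).$$ -/

import Mathlib

open Set Filter Topology
open scoped Pointwise

/-- Extended real-valued functions `X → ℝ ∪ {+∞}` are modelled as functions into `EReal` that
never take the value `-∞`; this predicate says that `f` is such a function and is lower
semicontinuous. -/
def IsLSCFun {X : Type*} [TopologicalSpace X] (f : X → EReal) : Prop :=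
  (∀ x, f x ≠ ⊥) ∧ LowerSemicontinuous f

/-- The effective domain `dom f = {x | f x < +∞}`. -/
def effDom {X : Type*} (f : X → EReal) : Set X := {x | f x < ⊤}

/-- Convexity of an extended real-valued function: its epigraph is convex. -/
def IsConvexFun {X : Type*} [AddCommGroup X] [Module ℝ X] (f : X → EReal) : Prop :=
  Convex ℝ {z : X × ℝ | f z.1 ≤ (z.2 : EReal)}

/-- `inf f(A)`. -/
noncomputable def infOn {X : Type*} (f : X → EReal) (A : Set X) : EReal := ⨅ x ∈ A, f x

/-- The multidirectional interval `[a, A] = {a + t (x - a) : t ∈ [0,1], x ∈ A}`. -/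
def multiInterval {X : Type*} [AddCommGroup X] [Module ℝ X] (a : X) (A : Set X) : Set X :=
  {y | ∃ t ∈ Icc (0 : ℝ) 1, ∃ x ∈ A, y = a + t • (x - a)}

section

variable {X : Type*} [NormedAddCommGroup X] [NormedSpace ℝ X]

/-- The enlargement `A_δ = A + δ B_X`, where `B_X` is the closed unit ball. -/
def enlargement (A : Set X) (δ : ℝ) : Set X := A + δ • Metric.closedBall (0 : X) 1

/-- The subdifferential of convex analysis at a point `x` where `f` is finite. -/
def convexSubdiff (f : X → EReal) (x : X) : Set (X →L[ℝ] ℝ) :=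
  {p | ∀ y, f x + ((p (y - x) : ℝ) : EReal) ≤ f y}

end

/-- A subdifferential operator assigns to a function `f` a multivalued map `X → 2^{X*}`.
Only its values at lower semicontinuous functions `X → ℝ ∪ {+∞}` are ever constrained or used. -/
abbrev SubdiffOperator (X : Type*) [NormedAddCommGroup X] [NormedSpace ℝ X] :=
  (X → EReal) → X → Set (X →L[ℝ] ℝ)

/-- Axioms (P1)--(P5). -/
structure SubdiffAxioms {X : Type*} [NormedAddCommGroup X] [NormedSpace ℝ X]
    (D : SubdiffOperator X) : Prop where
  /-- (P1) The subdifferential is empty off the domain. -/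
  empty_off_dom : ∀ f : X → EReal, IsLSCFun f → ∀ x, x ∉ effDom f → D f x = ∅
  /-- (P2) The subdifferential is local. -/
  congr_nhds : ∀ f g : X → EReal, IsLSCFun f → IsLSCFun g → ∀ x, f =ᶠ[𝓝 x] g → D f x = D g x
  /-- (P3) If `f` is convex, and finite and continuous near `x`, then the subdifferential is that
  of convex analysis. -/
  eq_convexSubdiff : ∀ f : X → EReal, IsLSCFun f → IsConvexFun f → ∀ x,
    (∀ᶠ y in 𝓝 x, y ∈ effDom f ∧ ContinuousAt f y) → D f x = convexSubdiff f x
  /-- (P4) Local minima in the domain are critical points. -/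
  zero_mem : ∀ f : X → EReal, IsLSCFun f → ∀ x ∈ effDom f, IsLocalMin f x → 0 ∈ D f x
  /-- (P5) Fuzzy sum rule; the minimum of `f + g` is understood to be finite. -/
  fuzzy_sum : ∀ f : X → EReal, IsLSCFun f → ∀ g : X → ℝ, ConvexOn ℝ univ g → Continuous g →
    ∀ xbar ∈ effDom f, (∀ z, f xbar + (g xbar : EReal) ≤ f z + (g z : EReal)) →
    ∀ ε : ℝ, 0 < ε →
      ∃ x ∈ Metric.ball xbar ε, ∃ y ∈ Metric.ball xbar ε,
      ∃ p ∈ D f x, ∃ q ∈ D (fun z => (g z : EReal)) y,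
        f xbar - (ε : EReal) < f x ∧ f x < f xbar + (ε : EReal) ∧ ‖p + q‖ < ε

/-- A feasible subdifferential on `X`: (P1)--(P5) together with (P6). A functional `q` on `X × ℝ`
is identified with the pair `(q (·, 0), q (0, 1))` in `X* × ℝ`. -/
structure IsFeasibleSubdiff {X : Type*} [NormedAddCommGroup X] [NormedSpace ℝ X]
    (D : SubdiffOperator X) : Prop extends SubdiffAxioms D where
  /-- (P6) Compatibility with a subdifferential on `X × ℝ` satisfying (P1)--(P5). -/
  product : ∃ D' : SubdiffOperator (X × ℝ), SubdiffAxioms D' ∧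
    ∀ f : X → EReal, IsLSCFun f → ∀ κ : ℝ, ∀ x : X, ∀ t : ℝ,
      ∀ q ∈ D' (fun z : X × ℝ => f z.1 + ((κ * z.2 : ℝ) : EReal)) (x, t),
        q.comp (ContinuousLinearMap.inl ℝ X ℝ) ∈ D f x ∧ q (0, 1) = κ

/-!
Passing to `X × ℝ` with the tilted function `f x + (f a - r) * t`, the vertex `(a, 0)` and the set
`A × {1}` reduces the inequality to the case of equal values: if `f > f a` with a gap near `A`, then
there is a subgradient `p` near `[a, A]` with `p a < inf p(A)`. Property (P6) says that subgradients
of the tilted function are pairs `(p, f a - r)`, so this inequality translates back to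
`inf p(A) - p a > r - f a`.

If `f` is bounded below near `[a, A]`, Ekeland's variational principle gives a minimizer of a small
perturbation of `f + l • d(·, A) + k • d(·, [a, A])`. For small `l` it lies away from `A`, where
`f` is too large, and for large `k` it lies near `[a, A]`. The fuzzy sum rule (P5) replaces
stationarity there by subgradients `p` of `f` and `q` of the convex penalty with `p + q` small.
Testing `q` on points of `A` and on an almost nearest point of `[a, A]`, the contributions of the
large constant `k` cancel, and `p` is larger on `A` than at a point of `[a, A]`, hence than at `a`.
This is `SubdiffAxioms.exists_subgradient_of_bddBelow`.

In general `f` need not be bounded below near `[a, A]`. If `z ∈ [a, A]`, then `p z < inf p(A)`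
implies `p a < inf p(A)`, so the vertex may be moved to any `z ∈ [a, A]` with `f z ≤ f a`. Moving it
repeatedly, to points where `f` is ever lower, must lead after finitely many steps to a vertex for
which `f` is bounded below: the successive vertices lie in nested drops and stay away from `A`, which
forces them to converge, and at the limit `f` would be `-∞`. To have room for a uniform
neighbourhood, the set `A` is slightly enlarged at each move. This is
`exists_le_on_multiInterval_thickening`.
-/

/-! ### Distance functions, multidirectional intervals and telescoping sequences -/

theorem convexOn_infDist {X : Type*} [NormedAddCommGroup X] [NormedSpace ℝ X] {C : Set X}
    (hC : Convex ℝ C) (hne : C.Nonempty) : ConvexOn ℝ univ (fun x => Metric.infDist x C) := by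
  refine ⟨convex_univ, fun x _ y _ s t hs ht hst => ?_⟩
  refine le_of_forall_pos_lt_add fun e he => ?_
  obtain ⟨u, hu, hxu⟩ := (Metric.infDist_lt_iff hne).1 (lt_add_of_pos_right (Metric.infDist x C) he)
  obtain ⟨v, hv, hyv⟩ := (Metric.infDist_lt_iff hne).1 (lt_add_of_pos_right (Metric.infDist y C) he)
  have h1 : dist (s • x + t • y) (s • u + t • v) ≤ s * dist x u + t * dist y v := by
    rw [dist_eq_norm, dist_eq_norm, dist_eq_norm]
    calc ‖s • x + t • y - (s • u + t • v)‖ = ‖s • (x - u) + t • (y - v)‖ := by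
          congr 1; simp only [smul_sub]; abel
      _ ≤ ‖s • (x - u)‖ + ‖t • (y - v)‖ := norm_add_le _ _
      _ = _ := by rw [norm_smul, norm_smul, Real.norm_of_nonneg hs, Real.norm_of_nonneg ht]
  refine (Metric.infDist_lt_iff hne).2 ⟨s • u + t • v, hC hu hv hs ht hst, h1.trans_lt ?_⟩
  simp only [smul_eq_mul]
  rcases hs.eq_or_lt with rfl | hs'
  · have : t = 1 := by linarith
    subst this; linarith
  · nlinarith

theorem multiInterval_subset {X : Type*} [AddCommGroup X] [Module ℝ X] {C K : Set X} {z : X}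
    (hK : Convex ℝ K) (hz : z ∈ K) (hC : C ⊆ K) : multiInterval z C ⊆ K := by
  rintro _ ⟨t, ht, x, hx, rfl⟩
  exact hK.add_smul_sub_mem hz (hC hx) ht

theorem subset_multiInterval {X : Type*} [AddCommGroup X] [Module ℝ X] (z : X) (C : Set X) :
    C ⊆ multiInterval z C := fun x hx => ⟨1, by simp, x, hx, by simp⟩

theorem left_mem_multiInterval {X : Type*} [AddCommGroup X] [Module ℝ X] (z : X) {C : Set X}
    (hC : C.Nonempty) : z ∈ multiInterval z C :=
  let ⟨x, hx⟩ := hC; ⟨0, by simp, x, hx, by simp⟩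

theorem multiInterval_eq_convexJoin {X : Type*} [AddCommGroup X] [Module ℝ X] (z : X) (C : Set X) :
    multiInterval z C = convexJoin ℝ {z} C := by
  ext y
  simp only [multiInterval, mem_ofPred_eq, convexJoin_singleton_left, mem_iUnion, exists_prop,
    segment_eq_image', mem_image]
  constructor
  · rintro ⟨t, ht, x, hx, rfl⟩; exact ⟨x, hx, t, ht, rfl⟩
  · rintro ⟨x, hx, t, ht, rfl⟩; exact ⟨t, ht, x, hx, rfl⟩

theorem Convex.multiInterval {X : Type*} [AddCommGroup X] [Module ℝ X] {C : Set X}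
    (hC : Convex ℝ C) (z : X) : Convex ℝ (multiInterval z C) := by
  rw [multiInterval_eq_convexJoin]
  exact (convex_singleton z).convexJoin hC

theorem Bornology.IsBounded.multiInterval {X : Type*} [NormedAddCommGroup X] [NormedSpace ℝ X]
    {C : Set X} (hC : Bornology.IsBounded C) (z : X) :
    Bornology.IsBounded (multiInterval z C) :=
  (isBounded_convexHull.2 (hC.insert z)).subset <|
    multiInterval_subset (convex_convexHull ℝ _) (subset_convexHull ℝ _ (mem_insert _ _))
      ((subset_insert _ _).trans (subset_convexHull ℝ _))

/-- A lower bound for a linear functional on `C` that exceeds its value at a point of `[a, C]`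
also exceeds its value at `a`. -/
theorem lt_of_mem_multiInterval {X : Type*} [AddCommGroup X] [Module ℝ X] {C : Set X} {a z : X}
    (hz : z ∈ multiInterval a C) (p : X →ₗ[ℝ] ℝ) {s : ℝ} (hp : ∀ y ∈ C, s ≤ p y) (hs : p z < s) :
    p a < s := by
  obtain ⟨t, ⟨h0, h1⟩, b, hb, rfl⟩ := hz
  have hb' := hp b hb
  simp only [map_add, map_smul, map_sub, smul_eq_mul] at hs
  by_contra! h
  nlinarith

theorem cauchySeq_of_dist_le_sub {X : Type*} [PseudoMetricSpace X] {u : ℕ → X} {v : ℕ → ℝ} {m : ℝ}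
    (hm : ∀ n, m ≤ v n) (h : ∀ n, dist (u n) (u (n + 1)) ≤ v n - v (n + 1)) : CauchySeq u := by
  refine cauchySeq_of_dist_le_of_summable _ h ?_
  refine summable_of_sum_range_le (c := v 0 - m) (fun n => dist_nonneg.trans (h n)) fun n => ?_
  rw [Finset.sum_range_sub']
  linarith [hm n]

/-! ### Ekeland's variational principle -/

theorem LowerSemicontinuous.add_coe_real {X : Type*} [TopologicalSpace X] {F : X → EReal}
    (hF : LowerSemicontinuous F) {g : X → ℝ} (hg : Continuous g) :
    LowerSemicontinuous (fun x => F x + (g x : EReal)) :=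
  hF.add' (continuous_coe_real_ereal.comp hg).lowerSemicontinuous fun x =>
    EReal.continuousAt_add (by simp) (by simp)

/-- **Ekeland's variational principle**, in its weak form, for extended real-valued functions. -/
theorem exists_forall_le_add_dist {X : Type*} [PseudoMetricSpace X] [CompleteSpace X]
    {F : X → EReal} (hF : LowerSemicontinuous F) {m : ℝ} (hm : ∀ x, (m : EReal) ≤ F x)
    {x₀ : X} (h₀ : F x₀ ≠ ⊤) {ε : ℝ} (hε : 0 < ε) :
    ∃ x, F x ≤ F x₀ ∧ ∀ y, F x ≤ F y + ((ε * dist y x : ℝ) : EReal) := by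
  set V : X → ℝ := fun x => (F x).toReal with hV
  have hbot : ∀ x, F x ≠ ⊥ := fun x h => by simpa [h] using hm x
  have hcoe : ∀ x, F x ≠ ⊤ → F x = (V x : EReal) := fun x hx => (EReal.coe_toReal hx (hbot x)).symm
  have hmV : ∀ x, F x ≠ ⊤ → m ≤ V x := fun x hx => by
    have := hm x; rw [hcoe x hx] at this; exact_mod_cast this
  -- The Ekeland order: `R y x` says that `y` improves on `x` at the rate `ε`.
  let R : X → X → Prop := fun y x => F y ≠ ⊤ ∧ V y + ε * dist y x ≤ V x
  have hRF : ∀ x y, F x ≠ ⊤ → F y + ((ε * dist y x : ℝ) : EReal) ≤ F x → R y x := by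
    intro x y hx h
    have hy : F y ≠ ⊤ := by
      intro hy; rw [hy, EReal.top_add_coe, top_le_iff] at h; exact hx h
    rw [hcoe x hx, hcoe y hy] at h
    exact ⟨hy, by exact_mod_cast h⟩
  have hRt : ∀ x y z, R z y → R y x → R z x := by
    rintro x y z ⟨hz, h1⟩ ⟨-, h2⟩
    refine ⟨hz, ?_⟩
    nlinarith [dist_triangle z y x]
  -- Each step descends at least half of what is possible.
  have hstep : ∀ x : {x // F x ≠ ⊤}, ∃ y : {x // F x ≠ ⊤},
      R y x ∧ ∀ w, R w x → 2 * V y ≤ V x + V w := by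
    rintro ⟨x, hx⟩
    have hRx : R x x := ⟨hx, by simp⟩
    set S : Set ℝ := V '' {w | R w x}
    have hSb : BddBelow S := ⟨m, by rintro _ ⟨w, hw, rfl⟩; exact hmV w hw.1⟩
    have hle : ∀ w, R w x → sInf S ≤ V w := fun w hw => csInf_le hSb ⟨w, hw, rfl⟩
    rcases (hle x hRx).eq_or_lt with h | h
    · exact ⟨⟨x, hx⟩, hRx, fun w hw => by have := hle w hw; dsimp only; linarith⟩
    · obtain ⟨_, ⟨y, hy, rfl⟩, hlt⟩ := exists_lt_of_csInf_lt (s := S) ⟨_, x, hRx, rfl⟩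
        (show sInf S < (V x + sInf S) / 2 by linarith)
      exact ⟨⟨y, hy.1⟩, hy, fun w hw => by have := hle w hw; dsimp only; linarith⟩
  choose next hn1 hn2 using hstep
  let u : ℕ → {x // F x ≠ ⊤} := fun n => Nat.rec ⟨x₀, h₀⟩ (fun _ x => next x) n
  have hu1 : ∀ n : ℕ, R (u (n + 1)).1 (u n).1 := fun n => hn1 (u n)
  have hu2 : ∀ (n : ℕ) w, R w (u n).1 → 2 * V (u (n + 1)).1 ≤ V (u n).1 + V w := fun n => hn2 (u n)
  have hRle : ∀ n k : ℕ, R (u (n + k)).1 (u n).1 := by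
    intro n k
    induction k with
    | zero => exact ⟨(u n).2, by simp⟩
    | succ k ih => exact hRt _ _ _ (hu1 (n + k)) ih
  have hanti : Antitone fun n : ℕ => V (u n).1 := antitone_nat_of_succ_le fun n => by
    have := (hu1 n).2
    have : 0 ≤ ε * dist (u (n + 1) : X) (u n) := by positivity
    linarith
  have hcauchy : CauchySeq fun n : ℕ => (u n).1 := by
    refine cauchySeq_of_dist_le_sub (v := fun n : ℕ => V (u n).1 / ε) (m := m / ε)
      (fun n => by have := hmV _ (u n).2; gcongr) fun n => ?_
    rw [← sub_div, le_div_iff₀ hε, dist_comm]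
    linarith [(hu1 n).2]
  obtain ⟨x, hx⟩ := cauchySeq_tendsto_of_complete hcauchy
  obtain ⟨L, hL⟩ : ∃ L, Tendsto (fun n : ℕ => V (u n).1) atTop (𝓝 L) :=
    ⟨_, tendsto_atTop_ciInf hanti ⟨m, by rintro _ ⟨n, rfl⟩; exact hmV _ (u n).2⟩⟩
  have hRx : ∀ n : ℕ, R x (u n).1 := by
    intro n
    have hcl := (hF.add_coe_real (g := fun y => ε * dist y (u n).1) (by fun_prop)).isClosed_preimage
      (V (u n).1 : EReal)
    refine hRF _ _ (u n).2 ?_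
    rw [hcoe _ (u n).2]
    refine hcl.mem_of_tendsto hx ?_
    filter_upwards [eventually_ge_atTop n] with k hk
    obtain ⟨j, rfl⟩ := Nat.exists_eq_add_of_le hk
    have h := hRle n j
    change F _ + _ ≤ _
    rw [hcoe _ h.1]
    exact_mod_cast h.2
  have hxT : F x ≠ ⊤ := (hRx 0).1
  have hxL : V x ≤ L := ge_of_tendsto' hL fun n => by
    have := (hRx n).2
    have : 0 ≤ ε * dist x (u n : X) := by positivity
    linarith
  refine ⟨x, ?_, fun y => ?_⟩
  · rw [hcoe _ h₀, hcoe _ hxT]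
    have h2 : V x + ε * dist x x₀ ≤ V x₀ := (hRx 0).2
    have : 0 ≤ ε * dist x x₀ := by positivity
    exact_mod_cast (by linarith : V x ≤ V x₀)
  · by_contra! hlt
    have hy := hRF x y hxT hlt.le
    have hLy : L ≤ V y := by
      have h1 : Tendsto (fun n => 2 * V (u (n + 1)).1 - V (u n).1) atTop (𝓝 (2 * L - L)) :=
        ((hL.comp (tendsto_add_atTop_nat 1)).const_mul 2).sub hL
      have := le_of_tendsto' h1 fun n => by
        have := hu2 n y (hRt _ _ _ hy (hRx n))
        show _ ≤ V y
        linarith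
      linarith
    rw [hcoe _ hxT, hcoe _ hy.1] at hlt
    have hlt' : V y + ε * dist y x < V x := by exact_mod_cast hlt
    have : 0 ≤ ε * dist y x := by positivity
    linarith

/-! ### The inequality for functions bounded below near the multidirectional interval -/

theorem SubdiffAxioms.add_le_of_mem {X : Type*} [NormedAddCommGroup X] [NormedSpace ℝ X]
    {D : SubdiffOperator X} (hD : SubdiffAxioms D) {g : X → ℝ} (hg : ConvexOn ℝ univ g)
    (hgc : Continuous g) {y : X} {q : X →L[ℝ] ℝ} (hq : q ∈ D (fun z => (g z : EReal)) y) (w : X) :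
    g y + q (w - y) ≤ g w := by
  have hcont : Continuous fun z => (g z : EReal) := continuous_coe_real_ereal.comp hgc
  rw [hD.eq_convexSubdiff _ ⟨fun x => EReal.coe_ne_bot _, hcont.lowerSemicontinuous⟩ ?_ y
    (Eventually.of_forall fun z => ⟨EReal.coe_lt_top _, hcont.continuousAt⟩)] at hq
  · have h := hq w
    dsimp only at h
    exact_mod_cast h
  · have := hg.convex_epigraph
    simpa [IsConvexFun] using this

/-- The mean value inequality under a lower bound for `f` near `[z, B]`. The function
`max f M + l • d(·, B) + k • d(·, [z, B])` is almost minimized near `[z, B]` and away from `B`.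
If `-q` is the subgradient found there and `y` the nearby point where `q` is a subgradient of the
penalty, then `q (b - y)`, for `b ∈ B`, is at most about `-l * d(y, B) - k * d(y, [z, B])`, while
`q (w - y)`, for `w ∈ [z, B]` almost nearest to `y`, is at least about `-(l + k) * d(y, [z, B])`.
The terms with the large constant `k` cancel. -/
theorem SubdiffAxioms.exists_subgradient_of_bddBelow {X : Type*} [NormedAddCommGroup X]
    [NormedSpace ℝ X] [CompleteSpace X] {D : SubdiffOperator X} (hD : SubdiffAxioms D)
    {f : X → EReal} (hf : IsLSCFun f) {B : Set X} (hne : B.Nonempty) (hconv : Convex ℝ B)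
    (hbdd : Bornology.IsBounded B) {z : X} {c M m η δ ε : ℝ} (hz : f z ≤ (c : EReal))
    (hη : 0 < η) (hM : ∀ x ∈ Metric.thickening η (multiInterval z B), (M : EReal) ≤ f x)
    (hδ : 0 < δ) (hcm : c < m) (hm : ∀ x ∈ Metric.thickening δ B, (m : EReal) ≤ f x)
    (hε : 0 < ε) :
    ∃ ξ ∈ Metric.thickening ε (multiInterval z B), f ξ < ((c + ε : ℝ) : EReal) ∧
      ∃ p ∈ D f ξ, ∃ s, p z < s ∧ ∀ b ∈ B, s ≤ p b := by
  set K := multiInterval z B with hKdef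
  have hzK : z ∈ K := left_mem_multiInterval z hne
  have hBK : B ⊆ K := subset_multiInterval z B
  have hKne : K.Nonempty := ⟨z, hzK⟩
  have hKc : Convex ℝ K := hconv.multiInterval z
  have hKb : Bornology.IsBounded K := hbdd.multiInterval z
  have hthick : ∀ {x : X} {r : ℝ} {S : Set X}, S.Nonempty →
      (x ∈ Metric.thickening r S ↔ Metric.infDist x S < r) := fun hS => by
    rw [Metric.mem_thickening_iff, Metric.infDist_lt_iff hS]
  have hMc : M ≤ c := by
    exact_mod_cast (hM z (Metric.self_subset_thickening hη _ hzK)).trans hz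
  -- The truncation keeps `f` unchanged on a neighbourhood of `K`.
  set f₁ : X → EReal := fun x => max (f x) M with hf₁
  have hf₁lsc : LowerSemicontinuous f₁ := hf.2.sup lowerSemicontinuous_const
  have hf₁M : ∀ x, (M : EReal) ≤ f₁ x := fun x => le_max_right _ _
  have hf₁f : ∀ x, f x ≤ f₁ x := fun x => le_max_left _ _
  have hf₁' : IsLSCFun f₁ := ⟨fun x => ne_bot_of_le_ne_bot (hf.1 x) (hf₁f x), hf₁lsc⟩
  have hf₁eq : ∀ x, Metric.infDist x K < η → f₁ x = f x := fun x hx =>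
    max_eq_left (hM x ((hthick hKne).2 hx))
  obtain ⟨l, hl, hlσ, hlε⟩ : ∃ l : ℝ, 0 < l ∧ l * Metric.infDist z B ≤ (m - c) / 2 ∧
      l * Metric.infDist z B ≤ ε / 4 := by
    have hL : 0 ≤ Metric.infDist z B := Metric.infDist_nonneg
    have hmin : 0 < min (m - c) ε := lt_min (sub_pos.2 hcm) hε
    have hl0 : 0 < min (m - c) ε / (4 * (Metric.infDist z B + 1)) := by positivity
    have heq : min (m - c) ε / (4 * (Metric.infDist z B + 1)) * (Metric.infDist z B + 1)
        = min (m - c) ε / 4 := by field_simp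
    refine ⟨_, hl0, ?_, ?_⟩
    · linarith [min_le_left (m - c) ε]
    · linarith [min_le_right (m - c) ε]
  obtain ⟨η', hη', hη1, hη2, hη3⟩ : ∃ η' : ℝ, 0 < η' ∧ η' ≤ η / 2 ∧ η' ≤ ε / 2 ∧ η' ≤ δ / 32 :=
    ⟨min (min (η / 2) (ε / 2)) (δ / 32), by positivity,
      (min_le_left _ _).trans (min_le_left _ _), (min_le_left _ _).trans (min_le_right _ _),
      min_le_right _ _⟩
  obtain ⟨k, hk, hkη⟩ : ∃ k : ℝ, 0 < k ∧ k * η' = m - M :=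
    ⟨(m - M) / η', div_pos (by linarith) hη', by field_simp⟩
  obtain ⟨R, hR, hRdiam⟩ : ∃ R : ℝ, 0 < R ∧ Metric.diam K + η' ≤ R :=
    ⟨_, by have : 0 ≤ Metric.diam K := Metric.diam_nonneg
           linarith, le_rfl⟩
  obtain ⟨e₁, he₁, he₁l, he₁R⟩ : ∃ e : ℝ, 0 < e ∧ e ≤ l ∧ e * R ≤ l * δ / 16 :=
    ⟨min l (l * δ / 16 / R), by positivity, min_le_left _ _,
      (le_div_iff₀ hR).1 (min_le_right _ _)⟩
  obtain ⟨e₂, he₂, he₂η, he₂R⟩ : ∃ e : ℝ, 0 < e ∧ e ≤ η' ∧ e * R ≤ l * δ / 16 :=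
    ⟨min η' (l * δ / 16 / R), by positivity, min_le_left _ _,
      (le_div_iff₀ hR).1 (min_le_right _ _)⟩
  set g₀ : X → ℝ := fun x => l * Metric.infDist x B + k * Metric.infDist x K with hg₀
  have hg₀nn : ∀ x, 0 ≤ g₀ x := fun x =>
    add_nonneg (mul_nonneg hl.le Metric.infDist_nonneg) (mul_nonneg hk.le Metric.infDist_nonneg)
  have hBcont := Metric.continuous_infDist_pt B
  have hKcont := Metric.continuous_infDist_pt K
  have hg₀c : Continuous g₀ := by fun_prop
  have hg₀z : g₀ z = l * Metric.infDist z B := by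
    simp [hg₀, Metric.infDist_zero_of_mem hzK]
  have hf₁z : f₁ z ≤ c := by
    rw [hf₁eq z (by rwa [Metric.infDist_zero_of_mem hzK])]; exact hz
  have hFz : f₁ z + (g₀ z : EReal) ≤ ((c + l * Metric.infDist z B : ℝ) : EReal) := by
    rw [hg₀z, EReal.coe_add]; gcongr
  obtain ⟨x₀, hx₀z, hx₀⟩ := exists_forall_le_add_dist (F := fun x => f₁ x + (g₀ x : EReal))
    (hf₁lsc.add_coe_real hg₀c) (m := M)
    (fun x => (hf₁M x).trans (le_add_of_nonneg_right (by exact_mod_cast hg₀nn x)))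
    (x₀ := z) (ne_top_of_le_ne_top (EReal.coe_ne_top _) hFz) he₁
  replace hx₀z := hx₀z.trans hFz
  have hx₀top : f₁ x₀ ≠ ⊤ := fun h => by
    rw [h, EReal.top_add_coe, top_le_iff] at hx₀z; exact EReal.coe_ne_top _ hx₀z
  obtain ⟨v, hv⟩ : ∃ v : ℝ, f₁ x₀ = v :=
    ⟨_, (EReal.coe_toReal hx₀top (hf₁'.1 x₀)).symm⟩
  have hvg : v + g₀ x₀ ≤ c + l * Metric.infDist z B := by
    rw [hv] at hx₀z; exact_mod_cast hx₀z
  have hMv : M ≤ v := by have := hf₁M x₀; rw [hv] at this; exact_mod_cast this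
  have hlB : 0 ≤ l * Metric.infDist x₀ B := mul_nonneg hl.le Metric.infDist_nonneg
  have hkK : 0 ≤ k * Metric.infDist x₀ K := mul_nonneg hk.le Metric.infDist_nonneg
  have hx₀K : Metric.infDist x₀ K < η' := by
    refine lt_of_mul_lt_mul_left ?_ hk.le
    rw [hkη]
    simp only [hg₀] at hvg
    linarith
  have hx₀B : δ ≤ Metric.infDist x₀ B := by
    by_contra! h
    have h1 := (hm x₀ ((hthick hne).2 h)).trans (hf₁f x₀)
    rw [hv] at h1
    have h2 : m ≤ v := by exact_mod_cast h1
    linarith [hg₀nn x₀]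
  set g : X → ℝ := fun x => g₀ x + e₁ * dist x x₀ with hg
  have hgc : Continuous g := by fun_prop
  have hgconv : ConvexOn ℝ univ g :=
    (((convexOn_infDist hconv hne).smul hl.le).add ((convexOn_infDist hKc hKne).smul hk.le)).add
      ((convexOn_univ_dist x₀).smul he₁.le)
  obtain ⟨x, hx, y, hy, p, hp, q, hq, -, hfx, hpq⟩ := hD.fuzzy_sum f₁ hf₁' g hgconv hgc x₀
    hx₀top.lt_top (fun w => by
      simp only [hg, dist_self, mul_zero, add_zero, EReal.coe_add]
      rw [← add_assoc]
      simpa using hx₀ w) e₂ he₂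
  rw [Metric.mem_ball] at hx hy
  have hxK : Metric.infDist x K < 2 * η' := by
    have := Metric.infDist_le_infDist_add_dist (s := K) (x := x) (y := x₀)
    linarith
  have hyK : Metric.infDist y K < 2 * η' := by
    have := Metric.infDist_le_infDist_add_dist (s := K) (x := y) (y := x₀)
    linarith
  have hyB : δ - δ / 32 ≤ Metric.infDist y B := by
    have := Metric.infDist_le_infDist_add_dist (s := B) (x := x₀) (y := y)
    rw [dist_comm] at this
    linarith
  have hD_eq : D f₁ x = D f x := by
    refine hD.congr_nhds _ _ hf₁' hf x ?_
    have : ∀ᶠ w in 𝓝 x, Metric.infDist w K < η :=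
      hKcont.continuousAt.eventually_lt continuousAt_const (by linarith)
    exact this.mono hf₁eq
  rw [hD_eq] at hp
  have hq' := hD.add_le_of_mem hgconv hgc hq
  have hlip : ∀ w, g w - g y ≤ (l + k + e₁) * dist w y := by
    intro w
    have h1 := Metric.infDist_le_infDist_add_dist (s := B) (x := w) (y := y)
    have h2 := Metric.infDist_le_infDist_add_dist (s := K) (x := w) (y := y)
    have h3 := dist_triangle w y x₀
    simp only [hg, hg₀]
    nlinarith
  obtain ⟨θ, hθ, hθl⟩ : ∃ θ : ℝ, 0 < θ ∧ (l + k + e₁) * θ = l * δ / 16 :=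
    ⟨l * δ / 16 / (l + k + e₁), by positivity, by field_simp⟩
  obtain ⟨w, hwK, hyw⟩ := (Metric.infDist_lt_iff hKne).1
    (lt_add_of_pos_right (Metric.infDist y K) hθ)
  have hqw : q y - q w ≤ (l + k + e₁) * (Metric.infDist y K + θ) := by
    have h1 := hq' (y + (y - w))
    have h2 := hlip (y + (y - w))
    have h3 : dist (y + (y - w)) y = dist y w := by simp [dist_eq_norm]
    rw [h3] at h2
    simp only [add_sub_cancel_left, map_sub] at h1
    have h4 : (l + k + e₁) * dist y w ≤ (l + k + e₁) * (Metric.infDist y K + θ) := by gcongr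
    linarith
  have hdiam : ∀ u ∈ K, ∀ u' ∈ K, dist u u' ≤ Metric.diam K := fun u hu u' hu' =>
    Metric.dist_le_diam_of_mem hKb hu hu'
  obtain ⟨w₀, hw₀K, hw₀⟩ := (Metric.infDist_lt_iff hKne).1 hx₀K
  have key : ∀ b ∈ B, p w + l * δ / 2 ≤ p b := by
    intro b hb
    have hbx₀ : dist b x₀ ≤ R := by
      have h1 := dist_triangle b w₀ x₀
      have h2 := hdiam b (hBK hb) w₀ hw₀K
      rw [dist_comm] at hw₀
      linarith
    have hwb : dist w b ≤ R := by linarith [hdiam w hwK b (hBK hb)]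
    have h1 := hq' b
    simp only [hg, hg₀, Metric.infDist_zero_of_mem hb, Metric.infDist_zero_of_mem (hBK hb),
      map_sub] at h1
    have h2 : (p + q) (w - b) ≤ e₂ * R := by
      refine (Real.le_norm_self _).trans (((p + q).le_opNorm _).trans ?_)
      rw [← dist_eq_norm]
      gcongr
    simp only [add_apply, map_sub] at h2
    have h3 : e₁ * dist b x₀ ≤ e₁ * R := by gcongr
    have h4 : 0 ≤ e₁ * dist y x₀ := by positivity
    have h5 : l * (δ - δ / 32) ≤ l * Metric.infDist y B := by gcongr
    have h6 : (l + e₁) * Metric.infDist y K ≤ (l + l) * (2 * η') := by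
      gcongr
      exact Metric.infDist_nonneg
    have h7 : l * η' ≤ l * (δ / 32) := by gcongr
    have h8 : 0 < l * δ := by positivity
    linarith
  have hτ : 0 < l * δ / 2 := by positivity
  refine ⟨x, (hthick hKne).2 (by linarith), ?_, p, hp, p w + l * δ / 2, ?_, key⟩
  · refine (hf₁f x).trans_lt (hfx.trans_le ?_)
    rw [hv]
    have := hg₀nn x₀
    exact_mod_cast (by linarith : v + e₂ ≤ c + ε)
  · exact lt_of_mem_multiInterval hwK p.toLinearMap key (by simpa using hτ)

/-! ### Removing the lower bound -/

/-- A lower bound on `[z, A_β']` gives one, by semicontinuity at `z`, on a uniform neighbourhood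
of `[z, A_β]` for `β < β'`: away from `z`, the former set contains such a neighbourhood. -/
theorem exists_le_on_thickening_multiInterval {X : Type*} [NormedAddCommGroup X] [NormedSpace ℝ X]
    {f : X → EReal} (hf : IsLSCFun f) {A : Set X} (hbdd : Bornology.IsBounded A) {z : X}
    {β β' M : ℝ} (hβ : β < β')
    (hM : ∀ x ∈ multiInterval z (Metric.thickening β' A), (M : EReal) ≤ f x) :
    ∃ η, 0 < η ∧ ∃ M' : ℝ, ∀ x ∈ Metric.thickening η (multiInterval z (Metric.thickening β A)),
      (M' : EReal) ≤ f x := by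
  obtain ⟨M₀, -, hM₀⟩ := EReal.lt_iff_exists_real_btwn.1 (bot_lt_iff_ne_bot.2 (hf.1 z))
  obtain ⟨ρ, hρ, hball⟩ := Metric.eventually_nhds_iff.1 (hf.2 z M₀ hM₀)
  obtain ⟨R, hR⟩ := (Metric.isBounded_iff_subset_closedBall z).1 (hbdd.thickening (δ := β))
  set R' := max R 1
  have hR' : 0 < R' := lt_of_lt_of_le one_pos (le_max_right _ _)
  set s := ρ / (2 * R') with hs
  have hs0 : 0 < s := by positivity
  have hsR : s * R' = ρ / 2 := by rw [hs]; field_simp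
  refine ⟨min (ρ / 2) (s * (β' - β)), lt_min (by positivity) (mul_pos hs0 (sub_pos.2 hβ)),
    min M M₀, fun x hx => ?_⟩
  obtain ⟨_, ⟨t, ⟨h0, h1⟩, b, hb, rfl⟩, hxw⟩ := Metric.mem_thickening_iff.1 hx
  have hbz : ‖b - z‖ ≤ R' := by
    have := hR hb
    rw [Metric.mem_closedBall, dist_eq_norm] at this
    exact this.trans (le_max_left _ _)
  rw [lt_min_iff] at hxw
  rcases le_or_gt t s with hts | hts
  · refine le_trans (by exact_mod_cast min_le_right _ _) (hball ?_).le
    have h2 : dist (z + t • (b - z)) z ≤ s * R' := by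
      rw [dist_eq_norm, add_sub_cancel_left, norm_smul, Real.norm_of_nonneg h0]
      gcongr
    linarith [dist_triangle x (z + t • (b - z)) z]
  · refine le_trans (by exact_mod_cast min_le_left _ _) (hM x ?_)
    have ht : 0 < t := hs0.trans hts
    obtain ⟨y, hy, hby⟩ := Metric.mem_thickening_iff.1 hb
    refine ⟨t, ⟨h0, h1⟩, b + t⁻¹ • (x - (z + t • (b - z))), ?_, ?_⟩
    · refine Metric.mem_thickening_iff.2 ⟨y, hy, ?_⟩
      have h2 : dist (b + t⁻¹ • (x - (z + t • (b - z)))) b < β' - β := by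
        rw [dist_eq_norm, add_sub_cancel_left, norm_smul, norm_inv, Real.norm_of_nonneg h0,
          ← dist_eq_norm, inv_mul_lt_iff₀ ht]
        exact hxw.2.trans_le (by gcongr)
      linarith [dist_triangle (b + t⁻¹ • (x - (z + t • (b - z)))) b y]
    · rw [add_sub_right_comm, smul_add, smul_inv_smul₀ ht.ne']
      abel

/-- If `f > c` near `A` and `f a ≤ c`, some `z` in the drop `[a, A_β]` with `f z ≤ c` has `f`
bounded below on the larger drop `[z, A_β']`. Otherwise there is a sequence of nested drops whose
vertices have values tending to `-∞`. The distances of the vertices to `A_δ` stay above `δ` and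
decrease by at least a fixed fraction of the step length, so the vertices converge, which
contradicts semicontinuity at the limit. -/
theorem exists_le_on_multiInterval_thickening {X : Type*} [NormedAddCommGroup X] [NormedSpace ℝ X]
    [CompleteSpace X] {f : X → EReal} (hf : IsLSCFun f) {A : Set X} (hne : A.Nonempty)
    (hconv : Convex ℝ A) (hbdd : Bornology.IsBounded A) {a : X} {c δ : ℝ} (ha : f a ≤ c)
    (hδ : 0 < δ) (hA : ∀ x ∈ Metric.thickening (2 * δ) A, (c : EReal) < f x) :
    ∃ β β' : ℝ, 0 < β ∧ β < β' ∧ β' < δ ∧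
      ∃ z ∈ multiInterval a (Metric.thickening β A), f z ≤ c ∧
      ∃ M : ℝ, ∀ x ∈ multiInterval z (Metric.thickening β' A), (M : EReal) ≤ f x := by
  by_contra! hcon
  set T := Metric.thickening δ A with hT
  have hTc : Convex ℝ T := hconv.thickening δ
  have hTne : T.Nonempty := hne.mono (Metric.self_subset_thickening hδ A)
  have hTsub : ∀ {β}, β < δ → Metric.thickening β A ⊆ T := fun h => Metric.thickening_mono h.le A
  have hTb : Bornology.IsBounded (multiInterval a T) := hbdd.thickening.multiInterval a
  let P : Type _ := {s : X × ℝ // 0 < s.2 ∧ s.2 < δ ∧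
    s.1 ∈ multiInterval a (Metric.thickening s.2 A) ∧ f s.1 ≤ c}
  have hstep : ∀ (n : ℕ) (s : P), ∃ s' : P,
      s'.1.1 ∈ multiInterval s.1.1 T ∧ f s'.1.1 < ((-n : ℝ) : EReal) := by
    rintro n ⟨⟨z, β⟩, hβ0, hβδ, hz, hfz⟩
    dsimp only at hβ0 hβδ hz hfz
    obtain ⟨x, hx, hfx⟩ := hcon β ((β + δ) / 2) hβ0 (by linarith) (by linarith) z hz hfz
      (min c (-n))
    refine ⟨⟨(x, (β + δ) / 2), by dsimp only; linarith, by dsimp only; linarith, ?_,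
      hfx.le.trans (by exact_mod_cast min_le_left _ _)⟩, ?_,
      hfx.trans_le (by exact_mod_cast min_le_right _ _)⟩
    · refine multiInterval_subset ((hconv.thickening _).multiInterval a) ?_
        (subset_multiInterval _ _) hx
      obtain ⟨t, ht, b, hb, rfl⟩ := hz
      exact ⟨t, ht, b, Metric.thickening_mono (by linarith) A hb, rfl⟩
    · obtain ⟨t, ht, b, hb, rfl⟩ := hx
      exact ⟨t, ht, b, hTsub (by linarith) hb, rfl⟩
  choose next hn1 hn2 using hstep
  have hmono : ∀ s : P, s.1.1 ∈ multiInterval a T := fun s => by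
    obtain ⟨t, ht, b, hb, h⟩ := s.2.2.2.1
    exact ⟨t, ht, b, hTsub s.2.2.1 hb, h⟩
  let u : ℕ → P := fun n => Nat.rec
    ⟨(a, δ / 2), by dsimp only; linarith, by dsimp only; linarith,
      left_mem_multiInterval a (hne.mono (Metric.self_subset_thickening (by linarith) A)), ha⟩
    (fun n s => next n s) n
  have hu1 : ∀ n : ℕ, (u (n + 1)).1.1 ∈ multiInterval (u n).1.1 T := fun n => hn1 n (u n)
  have hu2 : ∀ n : ℕ, f (u (n + 1)).1.1 < ((-n : ℝ) : EReal) := fun n => hn2 n (u n)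
  have hdist : ∀ n : ℕ, δ ≤ Metric.infDist (u n).1.1 T := by
    intro n
    refine (Metric.le_infDist hTne).2 fun y hy => ?_
    by_contra! h
    obtain ⟨x, hx, hyx⟩ := Metric.mem_thickening_iff.1 hy
    refine absurd (hA (u n).1.1 (Metric.mem_thickening_iff.2 ⟨x, hx, ?_⟩))
      (not_lt.2 (u n).2.2.2.2)
    linarith [dist_triangle (u n).1.1 y x]
  have hcauchy : CauchySeq fun n : ℕ => (u n).1.1 := by
    refine cauchySeq_of_dist_le_sub (m := 0)
      (v := fun n : ℕ => Metric.diam (multiInterval a T) / δ * Metric.infDist (u n).1.1 T)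
      (fun n => mul_nonneg (div_nonneg Metric.diam_nonneg hδ.le) Metric.infDist_nonneg)
      fun n => ?_
    obtain ⟨t, ⟨h0, h1⟩, b, hb, h⟩ := hu1 n
    have hd : dist (u n).1.1 (u (n + 1)).1.1 ≤ t * Metric.diam (multiInterval a T) := by
      rw [h, dist_eq_norm, sub_add_cancel_left, norm_neg, norm_smul, Real.norm_of_nonneg h0,
        ← dist_eq_norm]
      gcongr
      exact Metric.dist_le_diam_of_mem hTb (subset_multiInterval a T hb) (hmono _)
    have hi : Metric.infDist (u (n + 1)).1.1 T ≤ (1 - t) * Metric.infDist (u n).1.1 T := by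
      have h2 := (convexOn_infDist hTc hTne).2 (mem_univ (u n).1.1) (mem_univ b)
        (sub_nonneg.2 h1) h0 (sub_add_cancel 1 t)
      dsimp only at h2
      rw [Metric.infDist_zero_of_mem hb, smul_zero, add_zero, smul_eq_mul] at h2
      rw [h]
      refine le_of_eq_of_le ?_ h2
      congr 1
      module
    have ht : t * δ ≤ Metric.infDist (u n).1.1 T - Metric.infDist (u (n + 1)).1.1 T := by
      nlinarith [hdist n]
    rw [← mul_sub, div_mul_eq_mul_div, le_div_iff₀ hδ]
    have h3 : (0 : ℝ) ≤ Metric.diam (multiInterval a T) := Metric.diam_nonneg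
    nlinarith
  obtain ⟨z, hz⟩ := cauchySeq_tendsto_of_complete hcauchy
  obtain ⟨M, -, hM⟩ := EReal.lt_iff_exists_real_btwn.1 (bot_lt_iff_ne_bot.2 (hf.1 z))
  have hev := (hz.comp (tendsto_add_atTop_nat 1)).eventually (hf.2 z M hM)
  obtain ⟨N, hN⟩ := exists_nat_ge (-M)
  obtain ⟨n, hn, hnN⟩ := (hev.and (eventually_ge_atTop N)).exists
  have h1 : M < -n := by exact_mod_cast hn.trans (hu2 n)
  have h2 : (N : ℝ) ≤ n := by exact_mod_cast hnN
  linarith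

/-- The case `r = f a` of the mean value inequality, with no lower bound imposed on `f`. -/
theorem SubdiffAxioms.exists_subgradient {X : Type*} [NormedAddCommGroup X]
    [NormedSpace ℝ X] [CompleteSpace X] {D : SubdiffOperator X} (hD : SubdiffAxioms D)
    {f : X → EReal} (hf : IsLSCFun f) {A : Set X} (hne : A.Nonempty) (hconv : Convex ℝ A)
    (hbdd : Bornology.IsBounded A) {a : X} {c m δ ε : ℝ} (ha : f a ≤ (c : EReal))
    (hδ : 0 < δ) (hcm : c < m) (hm : ∀ x ∈ Metric.thickening δ A, (m : EReal) ≤ f x)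
    (hε : 0 < ε) :
    ∃ ξ ∈ Metric.thickening ε (multiInterval a A), f ξ < ((c + ε : ℝ) : EReal) ∧
      ∃ p ∈ D f ξ, ∃ s, p a < s ∧ ∀ b ∈ A, s ≤ p b := by
  obtain ⟨δ', hδ', hδ1, hδ2⟩ : ∃ δ' : ℝ, 0 < δ' ∧ δ' ≤ δ / 2 ∧ δ' ≤ ε / 2 :=
    ⟨min (δ / 2) (ε / 2), by positivity, min_le_left _ _, min_le_right _ _⟩
  obtain ⟨β, β', hβ, hββ', hβ', z, hz, hfz, M, hM⟩ :=
    exists_le_on_multiInterval_thickening hf hne hconv hbdd ha hδ' fun x hx =>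
      (EReal.coe_lt_coe_iff.2 hcm).trans_le (hm x (Metric.thickening_mono (by linarith) A hx))
  obtain ⟨η, hη, M', hM'⟩ := exists_le_on_thickening_multiInterval hf hbdd hββ' hM
  have hAB := Metric.self_subset_thickening hβ A
  have hBconv := hconv.thickening β
  obtain ⟨ξ, hξ, hfξ, p, hp, s, hs, hsB⟩ := hD.exists_subgradient_of_bddBelow hf
    (hne.mono hAB) hBconv hbdd.thickening hfz hη hM' hδ' hcm
    (fun x hx => hm x (Metric.thickening_mono (by linarith) A
      (Metric.thickening_thickening_subset δ' β A hx))) (half_pos hε)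
  refine ⟨ξ, ?_, hfξ.trans (by exact_mod_cast by linarith), p, hp, s,
    lt_of_mem_multiInterval hz p.toLinearMap hsB hs, fun b hb => hsB b (hAB hb)⟩
  obtain ⟨w, hw, hξw⟩ := Metric.mem_thickening_iff.1 hξ
  obtain ⟨t, ⟨h0, h1⟩, b, hb, rfl⟩ := multiInterval_subset (hBconv.multiInterval a) hz
    (subset_multiInterval _ _) hw
  obtain ⟨y, hy, hby⟩ := Metric.mem_thickening_iff.1 hb
  refine Metric.mem_thickening_iff.2 ⟨a + t • (y - a), ⟨t, ⟨h0, h1⟩, y, hy, rfl⟩, ?_⟩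
  have h2 : dist (a + t • (b - a)) (a + t • (y - a)) ≤ dist b y := by
    rw [dist_add_left, dist_eq_norm, ← smul_sub, sub_sub_sub_cancel_right, norm_smul,
      Real.norm_of_nonneg h0, ← dist_eq_norm]
    exact mul_le_of_le_one_left dist_nonneg h1
  linarith [dist_triangle ξ (a + t • (b - a)) (a + t • (y - a))]

/-! ### Reduction to equal values on a product space -/

theorem mem_enlargement_of_dist_le {X : Type*} [NormedAddCommGroup X] [NormedSpace ℝ X]
    {A : Set X} {x y : X} {δ : ℝ} (hδ : 0 ≤ δ) (hy : y ∈ A) (h : dist x y ≤ δ) :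
    x ∈ enlargement A δ := by
  rw [enlargement, smul_unitClosedBall_of_nonneg hδ]
  exact ⟨y, hy, x - y, by simpa [dist_eq_norm] using h, by simp⟩

theorem mainTheorem2 {X : Type*} [NormedAddCommGroup X] [NormedSpace ℝ X] [CompleteSpace X]
    (D : SubdiffOperator X) (hD : IsFeasibleSubdiff D)
    (A : Set X) (hne : A.Nonempty) (hconv : Convex ℝ A) (hbdd : Bornology.IsBounded A)
    (hclosed : IsClosed A) (a : X)
    (f : X → EReal) (hf : IsLSCFun f) (ha : a ∈ effDom f)
    (r : ℝ) (hr : (r : EReal) < ⨆ (δ : ℝ) (_ : 0 < δ), infOn f (enlargement A δ))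
    (ε : ℝ) (hε : 0 < ε) :
    ∃ ξ ∈ enlargement (multiInterval a A) ε,
      f ξ < max (f a) (r : EReal) + (ε : EReal) ∧
      ∃ p ∈ D f ξ,
        infOn (fun x => ((p x : ℝ) : EReal)) A - ((p a : ℝ) : EReal) > (r : EReal) - f a := by
  obtain ⟨D', hD', hprod⟩ := hD.product
  obtain ⟨c, hc⟩ : ∃ c : ℝ, f a = c := ⟨_, (EReal.coe_toReal ha.ne (hf.1 a)).symm⟩
  obtain ⟨δ, hr⟩ := lt_iSup_iff.1 hr
  obtain ⟨hδ, hr⟩ := lt_iSup_iff.1 hr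
  obtain ⟨r', hrr', hr'⟩ := EReal.lt_iff_exists_real_btwn.1 hr
  replace hrr' : r < r' := by exact_mod_cast hrr'
  have hfA : ∀ x ∈ enlargement A δ, (r' : EReal) ≤ f x := fun x hx =>
    hr'.le.trans (iInf₂_le x hx)
  -- With slope `c - r` the tilted function takes the value `c` at `(a, 0)` and values above `c`
  -- near `A × {1}`.
  set κ := c - r with hκ
  have hlsc : IsLSCFun fun w : X × ℝ => f w.1 + ((κ * w.2 : ℝ) : EReal) :=
    ⟨fun w => by
      rw [ne_eq, EReal.add_eq_bot_iff]
      exact not_or.2 ⟨hf.1 _, EReal.coe_ne_bot _⟩,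
      (hf.2.comp continuous_fst).add_coe_real (by fun_prop)⟩
  obtain ⟨δ', hδ', hδ1, hδκ⟩ : ∃ δ' : ℝ, 0 < δ' ∧ δ' ≤ δ ∧ |κ| * δ' ≤ (r' - r) / 2 := by
    have h0 : 0 < r' - r := sub_pos.2 hrr'
    refine ⟨min δ ((r' - r) / 2 / (|κ| + 1)), by positivity, min_le_left _ _, ?_⟩
    have h1 := (le_div_iff₀ (by positivity : 0 < |κ| + 1)).1
      (min_le_right δ ((r' - r) / 2 / (|κ| + 1)))
    have h2 : 0 < min δ ((r' - r) / 2 / (|κ| + 1)) := by positivity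
    linarith
  obtain ⟨e, he, heε, heκ⟩ : ∃ e : ℝ, 0 < e ∧ e ≤ ε ∧ (|κ| + 1) * e ≤ ε :=
    ⟨ε / (|κ| + 1), by positivity, div_le_self hε.le (by linarith [abs_nonneg κ]),
      (mul_div_cancel₀ _ (by positivity)).le⟩
  obtain ⟨⟨ξ, τ⟩, hξ, hfξ, q, hq, s, hs, hsA⟩ := hD'.exists_subgradient hlsc
    (A := A ×ˢ {(1 : ℝ)}) (hne.prod (singleton_nonempty _)) (hconv.prod (convex_singleton _))
    (hbdd.prod Bornology.isBounded_singleton) (a := (a, 0)) (c := c) (m := c + (r' - r) / 2)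
    (by simp [hc]) hδ' (by linarith) (by
      rintro ⟨x, t⟩ hx
      obtain ⟨⟨y, t'⟩, ⟨hy, ht'⟩, hxy⟩ := Metric.mem_thickening_iff.1 hx
      obtain rfl : t' = 1 := ht'
      rw [Prod.dist_eq, max_lt_iff] at hxy
      have h1 := hfA x (mem_enlargement_of_dist_le hδ.le hy (hxy.1.le.trans hδ1))
      have h2 : |κ * (t - 1)| ≤ (r' - r) / 2 := by
        rw [abs_mul]
        refine le_trans ?_ hδκ
        gcongr
        exact hxy.2.le
      have h3 : c + (r' - r) / 2 ≤ r' + κ * t := by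
        rw [hκ] at h2 ⊢
        linarith [(abs_le.1 h2).1]
      calc ((c + (r' - r) / 2 : ℝ) : EReal) ≤ ((r' + κ * t : ℝ) : EReal) := by exact_mod_cast h3
        _ = (r' : EReal) + ((κ * t : ℝ) : EReal) := EReal.coe_add _ _
        _ ≤ _ := by dsimp only; gcongr) he
  obtain ⟨hp, hqκ⟩ := hprod f hf κ ξ τ q hq
  set p := q.comp (ContinuousLinearMap.inl ℝ X ℝ) with hpdef
  have hqp : ∀ x t, q (x, t) = p x + t * κ := by
    intro x t
    have : ((x, t) : X × ℝ) = (x, 0) + t • (0, 1) := by simp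
    rw [this, map_add, map_smul, hqκ, smul_eq_mul]
    simp [hpdef]
  obtain ⟨⟨w, t'⟩, ⟨t, ⟨h0, h1⟩, ⟨y, t₁⟩, ⟨hy, ht₁⟩, hw⟩, hξw⟩ := Metric.mem_thickening_iff.1 hξ
  obtain rfl : t₁ = 1 := ht₁
  simp only [Prod.mk_sub_mk, Prod.smul_mk, Prod.mk_add_mk, Prod.mk.injEq, smul_eq_mul, sub_zero,
    mul_one, zero_add] at hw
  obtain ⟨rfl, rfl⟩ := hw
  rw [Prod.dist_eq, max_lt_iff] at hξw
  refine ⟨ξ, mem_enlargement_of_dist_le hε.le ⟨t', ⟨h0, h1⟩, y, hy, rfl⟩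
    (hξw.1.le.trans heε), ?_, p, hp, ?_⟩
  · have hfξtop : f ξ ≠ ⊤ := fun h => by
      dsimp only at hfξ
      rw [h, EReal.top_add_coe] at hfξ
      exact not_top_lt hfξ
    obtain ⟨v, hv⟩ : ∃ v : ℝ, f ξ = v := ⟨_, (EReal.coe_toReal hfξtop (hf.1 ξ)).symm⟩
    dsimp only at hfξ
    rw [hv] at hfξ
    have h2 : v + κ * τ < c + e := by exact_mod_cast hfξ
    have h3 : |κ * (τ - t')| ≤ |κ| * e := by
      rw [abs_mul]
      gcongr
      exact hξw.2.le
    -- Up to the error `|κ| * e`, the value is below the convex combination `(1 - t') * c + t' * r`.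
    have h4 : c - κ * t' ≤ max c r := by
      have h5 : (1 - t') * c ≤ (1 - t') * max c r :=
        mul_le_mul_of_nonneg_left (le_max_left _ _) (sub_nonneg.2 h1)
      have h6 : t' * r ≤ t' * max c r := mul_le_mul_of_nonneg_left (le_max_right _ _) h0
      rw [hκ]
      linarith
    have h5 : v < max c r + ε := by linarith [(abs_le.1 h3).1]
    rw [hv, hc, ← EReal.coe_strictMono.monotone.map_max, ← EReal.coe_add]
    exact EReal.coe_lt_coe_iff.2 h5
  · rw [hqp] at hs
    have h2 : ((s - κ : ℝ) : EReal) ≤ infOn (fun x => ((p x : ℝ) : EReal)) A := by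
      refine le_iInf₂ fun x hx => ?_
      have := hsA (x, 1) ⟨hx, rfl⟩
      rw [hqp] at this
      exact EReal.coe_le_coe_iff.2 (by linarith)
    have h3 : r - c < s - κ - p a := by linarith
    rw [hc]
    calc (r : EReal) - c < ((s - κ : ℝ) : EReal) - (p a : EReal) := by exact_mod_cast h3
      _ ≤ _ := EReal.sub_le_sub h2 le_rfl
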